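/- Let $k=\mathbb{F}_q$ be a finite field with $q$ elements, let $K$ be an algebraically closed field containing $k$, and let $G$ be a semiabelian variety over $K$ (a commutative algebraic group that is an extension of an abelian variety by a torus) which is defined over $k$, that is, $G=G_0\times_k K$ for a commutative group scheme $G_0$ over $k$. Let $F=\mathrm{Frob}_q$ be the Frobenius endomorphism of $G$ (the base change to $K$ of the $q$-Frobenius of $G_0$), and let $\Gamma=\mathbb{Z}g\subseteq G(K)$ be the cyclic group generated by a non-torsion point $g\in G(K)$. Let $d\ge 1$ and $r\ge 0$ be integers, let $\alpha_0,\alpha_{ij}\in G(K)$ for $1\le i\le d$, $0\le j\le r$, and suppose that the set $$S=\Big\{\alpha_0+\sum_{i=1}^{d}\sum_{j=0}^{r}F^{2^{j}n_i}(\alpha_{ij})\ \Big|\ n_1,\dots,n_d\in\mathbb{N}\Big\}$$ (where $0\in\mathbb{N}$) is contained in $\Gamma$. Suppose further that 1. $P(F)=0$ in the endomorphism ring of $G$, where $P(x)=(x-q)P_0(x)$ and $P_0\in\mathbb{Z}[x]$ is a monic polynomial all of whose complex roots have absolute value $\sqrt{q}$; and 2. for every integer $m\ge 1$, the only subgroup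 $H\subseteq\Gamma$ with $F^m(H)\subseteq H$ is $H=0$. Then there exist rational numbers $c_0$ and $c_{ij}$ ($1\le i\le d$, $0\le j\le r-1$) such that $$\{n\in\mathbb{Z}\mid n\cdot g\in S\}=\Big\{c_0+\sum_{i=1}^{d}\sum_{j=0}^{r-1}c_{ij}\,q^{2^{j}n_i}\ \Big|\ n_1,\dots,n_d\in\mathbb{N}\Big\}$$ as subsets of $\mathbb{Q}$. (For $r=0$ the inner sums are empty and the right-hand side is $\{c_0\}$.) -/

import Mathlib

open CategoryTheory AlgebraicGeometry MonoidalCategory CartesianMonoidalCategory Opposite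
open TopologicalSpace

universe u

namespace Semiabelian

noncomputable section

/-! ### The Frobenius endomorphism of a scheme over a finite field -/

section Frobenius

/-- The endomorphism `a ↦ a ^ q` of a commutative ring `A` which receives a ring homomorphism from
a finite field `k` with `q` elements. -/
def powCard {k A : Type*} [Field k] [Fintype k] [CommRing A] (f : k →+* A) : A →+* A :=
  letI := f.toAlgebra
  (FiniteField.frobeniusAlgHom k A).toRingHom

lemma powCard_apply {k A : Type*} [Field k] [Fintype k] [CommRing A] (f : k →+* A) (a : A) :
    powCard f a = a ^ Fintype.card k := rfl

variable {k : Type u} [Field k] [Fintype k]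

/-- The structure map from `k` to the sections of a `k`-scheme over an open subset. -/
def scalars (X : Over (Spec (.of k))) (U : X.left.Opens) : k →+* Γ(X.left, U) :=
  ((Scheme.ΓSpecIso (.of k)).inv ≫ X.hom.appTop ≫
    X.left.presheaf.map (homOfLE le_top : U ⟶ ⊤).op).hom

/-- The `q`-Frobenius of a `k`-scheme as a morphism of presheafed spaces: the identity on the
underlying space and `s ↦ s ^ q` on sections, where `q` is the number of elements of `k`. -/
def absFrobPre (X : Over (Spec (.of k))) :
    X.left.toPresheafedSpace.Hom X.left.toPresheafedSpace where
  base := 𝟙 _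
  c := { app := fun U => CommRingCat.ofHom (powCard (scalars X U.unop))
         naturality := by
          intro U V i
          ext a
          exact (map_pow (X.left.presheaf.map i).hom a _).symm }

/-- The `q`-Frobenius of a `k`-scheme as a morphism of schemes. -/
def absFrob (X : Over (Spec (.of k))) : X.left ⟶ X.left where
  toHom := absFrobPre X
  prop := by
    intro x
    constructor
    intro a ha
    obtain ⟨U, hx, s, rfl⟩ := X.left.presheaf.exists_germ_eq a
    have h := PresheafedSpace.stalkMap_germ_apply (absFrobPre X) U x hx s
    have h' : (X.left.presheaf.germ U x hx) ((absFrobPre X).c.app (op U) s) =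
        (X.left.presheaf.germ U x hx s) ^ Fintype.card k :=
      map_pow (X.left.presheaf.germ U x hx).hom s _
    have e := h.trans h'
    exact (isUnit_pow_iff Fintype.card_ne_zero).mp (e ▸ ha)

lemma absFrob_app (X : Over (Spec (.of k))) (U : X.left.Opens) (s : Γ(X.left, U)) :
    (absFrob X).app U s = s ^ Fintype.card k := rfl

lemma absFrob_naturality {X Y : Over (Spec (.of k))} (f : X ⟶ Y) :
    f.left ≫ absFrob Y = absFrob X ≫ f.left := by
  refine Scheme.Hom.ext (by rfl) fun U => ?_
  have h : ∀ e : (Opens.map (absFrob X ≫ f.left).base).obj U =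
      (Opens.map (f.left ≫ absFrob Y).base).obj U,
      X.left.presheaf.map (eqToHom e).op = 𝟙 _ := fun _ => X.left.presheaf.map_id _
  ext s
  have h1 : (f.left ≫ absFrob Y).app U s = (f.left.app U).hom (s ^ Fintype.card k) := rfl
  have h2 : (absFrob X ≫ f.left).app U s = ((f.left.app U).hom s) ^ Fintype.card k := rfl
  have h3 : (f.left ≫ absFrob Y).app U s = (absFrob X ≫ f.left).app U s := by
    rw [h1, h2, map_pow]
  erw [h]
  exact h3

lemma absFrob_comp_hom (X : Over (Spec (.of k))) : absFrob X ≫ X.hom = X.hom := by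
  apply ext_to_Spec
  ext a
  have h : (X.hom.appTop).hom ((Scheme.ΓSpecIso (.of k)).inv.hom a) ^ Fintype.card k =
      (X.hom.appTop).hom ((Scheme.ΓSpecIso (.of k)).inv.hom a) := by
    rw [← map_pow, ← map_pow]
    congr 2
    exact FiniteField.pow_card a
  exact h

/-- The `q`-Frobenius of a `k`-scheme as a morphism of `k`-schemes. -/
def frob (X : Over (Spec (.of k))) : X ⟶ X := Over.homMk (absFrob X) (absFrob_comp_hom X)

lemma frob_naturality {X Y : Over (Spec (.of k))} (f : X ⟶ Y) : f ≫ frob Y = frob X ≫ f :=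
  Over.OverMorphism.ext (absFrob_naturality f)

instance isMonHom_frob (X : Over (Spec (.of k))) [GrpObj X] : IsMonHom (frob X) where
  one_hom := by
    rw [frob_naturality, toUnit_unique (frob (𝟙_ _)) (𝟙 _), Category.id_comp]
  mul_hom := by
    rw [frob_naturality]
    congr 1
    ext1 <;> simp [← frob_naturality]

end Frobenius

/-! ### Commutative group schemes over a field and their points -/

/-- The category of commutative group schemes over a field `K`. -/
abbrev CommGroupScheme (K : Type u) [Field K] := CommGrp (Over (Spec (CommRingCat.of K)))

/-- Base change of commutative group schemes along a field extension `K / k`. -/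
def baseChange (k K : Type u) [Field k] [Field K] [Algebra k K] :
    CommGroupScheme k ⥤ CommGroupScheme K :=
  (Over.pullback (Spec.map (CommRingCat.ofHom (algebraMap k K)))).mapCommGrp

/-- The Frobenius endomorphism `Frob_q` of `G₀ ×_k K`, where `G₀` is a commutative group scheme
over the field `k` with `q` elements: the base change of the `q`-Frobenius of `G₀`. -/
def frobenius {k : Type u} (K : Type u) [Field k] [Fintype k] [Field K] [Algebra k K]
    (G₀ : CommGroupScheme k) : End ((baseChange k K).obj G₀) :=
  (baseChange k K).map
    (InducedCategory.homMk (Grp.homMk (A := G₀.toGrp) (B := G₀.toGrp) (frob G₀.X)))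

section Group

open scoped MonObj

variable {K : Type u} [Field K]

/-- The group `G(K)` of `K`-points of a commutative group scheme over `K`, written additively. -/
def Points (G : CommGroupScheme K) : Type u :=
  Additive (𝟙_ (Over (Spec (CommRingCat.of K))) ⟶ G.X)

instance (G : CommGroupScheme K) : AddCommGroup (Points G) :=
  inferInstanceAs (AddCommGroup (Additive (𝟙_ (Over (Spec (CommRingCat.of K))) ⟶ G.X)))

/-- The morphism of `K`-schemes underlying a homomorphism of commutative group schemes. -/
def schemeHom {G H : CommGroupScheme K} (f : G ⟶ H) : G.X ⟶ H.X := f.hom.hom.hom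

instance {G H : CommGroupScheme K} (f : G ⟶ H) : IsMonHom (schemeHom f) :=
  inferInstanceAs (IsMonHom f.hom.hom.hom)

/-- The endomorphism of the group `G(K)` induced by an endomorphism of `G`. -/
def onPoints {G : CommGroupScheme K} (F : End G) : AddMonoid.End (Points G) :=
  MonoidHom.toAdditive
    { toFun := fun x : 𝟙_ (Over (Spec (CommRingCat.of K))) ⟶ G.X => x ≫ schemeHom F
      map_one' := MonObj.one_comp _
      map_mul' := fun _ _ => MonObj.mul_comp _ _ _ }

/-- The abelian group of all morphisms of `K`-schemes `G → G`, with the pointwise group law of `G`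
written additively. It contains the additive group of the endomorphism ring of `G`. -/
def SelfMaps (G : CommGroupScheme K) : Type u := Additive (G.X ⟶ G.X)

instance (G : CommGroupScheme K) : AddCommGroup (SelfMaps G) :=
  inferInstanceAs (AddCommGroup (Additive (G.X ⟶ G.X)))

/-- An endomorphism of a commutative group scheme as an element of the group `SelfMaps G`. -/
def selfMap {G : CommGroupScheme K} (F : End G) : SelfMaps G := Additive.ofMul (schemeHom F)

/-- The value `P(F) = ∑ aᵢ Fⁱ` of an integer polynomial `P = ∑ aᵢ xⁱ` at an endomorphism `F` of a
commutative group scheme `G`. Here `Fⁱ` is the `i`-fold composition. -/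
def polyEval {G : CommGroupScheme K} (F : End G) (P : Polynomial ℤ) : SelfMaps G :=
  P.sum fun i a => a • selfMap (F ^ i)

/-! ### Semiabelian varieties -/

/-- An abelian variety: a proper and geometrically integral (commutative) group scheme. -/
structure IsAbelianVariety (A : CommGroupScheme K) : Prop where
  isProper : IsProper A.X.hom
  geometricallyIntegral : GeometricallyIntegral A.X.hom

variable (K) in
/-- The split torus `𝔾ₘⁿ = Spec K[ℤⁿ]`. -/
def splitTorus (n : ℕ) : CommGroupScheme K where
  X := (Spec (CommRingCat.of (AddMonoidAlgebra K (Fin n → ℤ)))).asOver (Spec (CommRingCat.of K))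

/-- A semiabelian variety over an algebraically closed field: a commutative group scheme of finite
type which is an extension `0 → T → G → A → 0` of an abelian variety by a torus (which is split,
the field being algebraically closed). Exactness means that `G → A` is flat and surjective, and
that `T` is its kernel, that is, its fibre over the unit section. -/
def IsSemiabelian [IsAlgClosed K] (G : CommGroupScheme K) : Prop :=
  LocallyOfFiniteType G.X.hom ∧ QuasiCompact G.X.hom ∧
    ∃ (n : ℕ) (A : CommGroupScheme K) (i : splitTorus K n ⟶ G) (π : G ⟶ A),
      IsAbelianVariety A ∧ Flat (schemeHom π).left ∧ Surjective (schemeHom π).left ∧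
        IsPullback (schemeHom i) (toUnit _) (schemeHom π) η[A.X]

end Group

/-! ### The two kinds of sets -/

/-- The set `{α₀ + ∑_{i=1}^d ∑_{j=0}^r F^{2^j nᵢ}(αᵢⱼ) | n₁, …, n_d ∈ ℕ}` for an endomorphism `F`
of an abelian group. -/
def widelyFSet {M : Type*} [AddCommGroup M] (F : AddMonoid.End M) (d r : ℕ) (α₀ : M)
    (α : Fin d → Fin (r + 1) → M) : Set M :=
  {x | ∃ n : Fin d → ℕ, x = α₀ + ∑ i, ∑ j : Fin (r + 1), (F ^ (2 ^ (j : ℕ) * n i)) (α i j)}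

/-- The set `{c₀ + ∑_{i=1}^d ∑_{0 ≤ j < s} cᵢⱼ q^{2^j nᵢ} | n₁, …, n_d ∈ ℕ}` of rational numbers.
The last parameter `s` counts the exponents `2^j`, so this is `S_{q,d,s-1}(c₀; cᵢⱼ)`; it is `{c₀}`
when `s = 0`. -/
def widelyPSet (q d s : ℕ) (c₀ : ℚ) (c : Fin d → Fin s → ℚ) : Set ℚ :=
  {x | ∃ n : Fin d → ℕ, x = c₀ + ∑ i, ∑ j : Fin s, c i j * (q : ℚ) ^ (2 ^ (j : ℕ) * n i)}

end

end Semiabelian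

/-! Pass to V = ℂ ⊗ G(K), where f, induced by F, is killed by (X − q)P₀. Since |q| ≠ √q the two
factors are coprime, so V is the sum of ker P₀(f) and ker(f − q), with projections E₀ and E₁. By
`not_eigenvector`, the absence of stable subgroups of Γ says that no positive power of f has g as an
eigenvector.

Freezing all the nᵢ but one leaves a relation a(n)g = γ + ∑ f^(2^j n)(βⱼ), which is projected to
both summands. Sequences in n are separated by the shift operator: the j-th term is killed by a
polynomial in the shift with roots of modulus √q^(2^j), respectively q^(2^j). If E₁g = 0, each term
of the E₀-part lies on the line of g (`terms_mem_line`); a nonzero one would make g an eigenvector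
of f^(2^j), so a is constant. If E₁g ≠ 0, the E₁-part gives a(n) = c + ∑_{j≤r} c'ⱼ q^(2^j n). On the
E₀-side all frequencies have modulus at most q^(2^(r−1/2)·2^(−1/2)) = q^(2^(r−1)), so q^(2^r) cannot
occur there: c'ᵣ E₀g = 0 (`top_coeff_eq_zero`). As E₀g = 0 would make g an eigenvector of f, c'ᵣ =
0. This is how the range of j drops by one.

The variables nᵢ enter additively, so the one-variable formulas add up. -/

/-! ### Sequences under the shift operator -/

section Shift

open Polynomial

variable {V : Type*} [AddCommGroup V] [Module ℂ V]

/-- The shift operator on sequences in a complex vector space. -/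
def seqShift (V : Type*) [AddCommGroup V] [Module ℂ V] : Module.End ℂ (ℕ → V) :=
  LinearMap.funLeft ℂ V Nat.succ

lemma seqShift_apply (w : ℕ → V) (n : ℕ) : seqShift V w n = w (n + 1) := rfl

/-- Polynomials in an operator `T` preserve `T`-stable subspaces. -/
lemma aeval_mem_of_stable {W : Type*} [AddCommGroup W] [Module ℂ W] (T : Module.End ℂ W)
    (N : Submodule ℂ W) (hN : ∀ w ∈ N, T w ∈ N) (P : ℂ[X]) {w : W} (hw : w ∈ N) :
    aeval T P w ∈ N := by
  induction P using Polynomial.induction_on generalizing w with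
  | C a => simpa using N.smul_mem a hw
  | add p q hp hq => simpa using N.add_mem (hp hw) (hq hw)
  | monomial n a h =>
    rw [pow_succ, ← mul_assoc, map_mul, aeval_X]
    exact h (hN w hw)

/-- The map `v ↦ (n ↦ hⁿ v)` intertwines `h` and the shift. -/
lemma aeval_seqShift_orbit (h : Module.End ℂ V) (P : ℂ[X]) (v : V) :
    aeval (seqShift V) P (fun n => (h ^ n) v) = fun n => (h ^ n) (aeval h P v) := by
  induction P using Polynomial.induction_on generalizing v with
  | C a => ext n; simp
  | add p q hp hq => ext n; simp [hp, hq]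
  | monomial n a ih =>
    have hX : ∀ T : Module.End ℂ (ℕ → V), aeval T (C a * X ^ (n + 1)) = aeval T (C a * X ^ n) * T :=
      fun T => by rw [pow_succ, ← mul_assoc, map_mul _ _ X, aeval_X]
    have hX' : aeval h (C a * X ^ (n + 1)) = aeval h (C a * X ^ n) * h := by
      rw [pow_succ, ← mul_assoc, map_mul _ _ X, aeval_X]
    rw [hX, hX']
    have e : seqShift V (fun n => (h ^ n) v) = fun n => (h ^ n) (h v) := by
      ext n
      rw [seqShift_apply, pow_succ]
      rfl
    rw [Module.End.mul_apply, e, ih]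
    rfl

/-- If a sum of vectors killed by pairwise coprime polynomials in `T` lies in a `T`-stable
subspace, then so does every summand. -/
lemma mem_of_sum_mem_of_coprime {W ι : Type*} [AddCommGroup W] [Module ℂ W] [Fintype ι]
    (T : Module.End ℂ W)
    (N : Submodule ℂ W) (hN : ∀ w ∈ N, T w ∈ N) (R : ι → ℂ[X]) (w : ι → W)
    (hR : ∀ i j, i ≠ j → IsCoprime (R i) (R j)) (hw : ∀ i, aeval T (R i) (w i) = 0)
    (hsum : ∑ i, w i ∈ N) (i : ι) : w i ∈ N := by
  classical
  -- By Bézout, `Q` is 1 modulo `R i` and 0 modulo every other `R j`, so `Q` in `T` extracts `w i`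
  -- from the sum.
  obtain ⟨a, b, hab⟩ : IsCoprime (R i) (∏ j ∈ Finset.univ.erase i, R j) :=
    IsCoprime.prod_right fun j hj => hR i j (Finset.ne_of_mem_erase hj).symm
  set Q := b * ∏ j ∈ Finset.univ.erase i, R j with hQ
  have hj : ∀ j, j ≠ i → aeval T Q (w j) = 0 := by
    intro j hji
    rw [hQ, ← Finset.prod_erase_mul _ _ (Finset.mem_erase.2 ⟨hji, Finset.mem_univ j⟩),
      ← mul_assoc, map_mul, Module.End.mul_apply, hw, map_zero]
  have hi : aeval T Q (w i) = w i := by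
    have h1 : Q = 1 - a * R i := by rw [← hab]; ring
    rw [h1, map_sub, map_mul, map_one, LinearMap.sub_apply, Module.End.mul_apply, hw]
    simp
  have := aeval_mem_of_stable T N hN Q hsum
  rwa [map_sum, Finset.sum_eq_single i (fun j _ h => hj j h) (by simp), hi] at this

/-- The subspace of sequences with values in a given line. -/
def lineSeq (v : V) : Submodule ℂ (ℕ → V) :=
  Submodule.pi Set.univ fun _ => Submodule.span ℂ {v}

lemma mem_lineSeq {v : V} {w : ℕ → V} : w ∈ lineSeq v ↔ ∀ n, ∃ c : ℂ, c • v = w n := by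
  simp [lineSeq, Submodule.mem_pi, Submodule.mem_span_singleton]

lemma seqShift_mem_lineSeq {v : V} {w : ℕ → V} (hw : w ∈ lineSeq v) : seqShift V w ∈ lineSeq v :=
  mem_lineSeq.2 fun n => mem_lineSeq.1 hw (n + 1)

/-- Over ℂ a common factor would give a common root, which cannot have two moduli. -/
lemma isCoprime_of_norm_roots {P Q : ℂ[X]} {s t : ℝ} (hst : s ≠ t)
    (hP : ∀ z : ℂ, aeval z P = 0 → ‖z‖ = s) (hQ : ∀ z : ℂ, aeval z Q = 0 → ‖z‖ = t) : IsCoprime P Q := by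
  rw [Polynomial.isCoprime_iff_aeval_ne_zero_of_isAlgClosed ℂ ℂ]
  intro z
  by_contra! h
  exact hst ((hP z h.1).symm.trans (hQ z h.2))

/-- The polynomial whose roots are the `m`-th powers of the roots of `P`. -/
noncomputable def powRoots (P : ℂ[X]) (m : ℕ) : ℂ[X] := (P.roots.map fun z => X - C (z ^ m)).prod

lemma norm_of_root_powRoots {P : ℂ[X]} {s : ℝ} (hP0 : P ≠ 0) (hP : ∀ z : ℂ, aeval z P = 0 → ‖z‖ = s)
    (m : ℕ) (z : ℂ) (hz : aeval z (powRoots P m) = 0) : ‖z‖ = s ^ m := by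
  rw [powRoots, map_multiset_prod, Multiset.prod_eq_zero_iff] at hz
  simp only [Multiset.map_map, Multiset.mem_map, Function.comp] at hz
  obtain ⟨y, hy, h⟩ := hz
  have hy' : ‖y‖ = s := hP y (by
    have := (mem_roots hP0).1 hy
    rwa [coe_aeval_eq_eval])
  have : z = y ^ m := by simpa [sub_eq_zero] using h
  rw [this, norm_pow, hy']

/-- Root by root, X − z divides X^m − z^m. Hence a polynomial relation for f yields one for f^m. -/
lemma dvd_powRoots_comp {P : ℂ[X]} (hP : P.Monic) (m : ℕ) :
    P ∣ (powRoots P m).comp (X ^ m) := by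
  have h1 : (P.roots.map fun z => X - C z).prod = P :=
    prod_multiset_X_sub_C_of_monic_of_roots_card_eq hP IsAlgClosed.card_roots_eq_natDegree
  have h2 : (powRoots P m).comp (X ^ m) = (P.roots.map fun z => X ^ m - C z ^ m).prod := by
    rw [powRoots, multiset_prod_comp, Multiset.map_map]
    simp
  rw [h2]
  nth_rewrite 1 [← h1]
  exact Multiset.prod_dvd_prod_of_dvd _ _ fun z _ => sub_dvd_pow_sub_pow _ _ _

lemma aeval_pow_powRoots (f : Module.End ℂ V) {P : ℂ[X]} (hP : P.Monic) (m : ℕ) (v : V)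
    (hv : aeval f P v = 0) : aeval (f ^ m) (powRoots P m) v = 0 := by
  obtain ⟨Q, hQ⟩ := dvd_powRoots_comp hP m
  have : aeval (f ^ m) (powRoots P m) = aeval f ((powRoots P m).comp (X ^ m)) := by
    rw [aeval_comp]; simp
  rw [this, hQ, mul_comm, map_mul, Module.End.mul_apply, hv, map_zero]

lemma pow_pow_seq (f : Module.End ℂ V) (m : ℕ) (v : V) :
    (fun n => (f ^ (m * n)) v) = fun n => ((f ^ m) ^ n) v := by
  simp only [pow_mul]

lemma pow_apply_of_eigen {f : Module.End ℂ V} {q : ℂ} {v : V} (h : f v = q • v) (n : ℕ) :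
    (f ^ n) v = q ^ n • v := by
  induction n with
  | zero => simp
  | succ n ih => rw [pow_succ, Module.End.mul_apply, h, map_smul, ih, smul_smul, pow_succ']

lemma aeval_seqShift_const (v : V) : aeval (seqShift V) (X - C 1 : ℂ[X]) (fun _ => v) = 0 := by
  ext n
  simp [seqShift_apply]

lemma norm_of_root_X_sub_C (a z : ℂ) (h : aeval z (X - C a : ℂ[X]) = 0) : ‖z‖ = ‖a‖ := by
  have : z = a := by simpa [sub_eq_zero] using h
  rw [this]

/-- If a constant plus terms `f ^ (2 ^ j * n) (β j)` has values in the line of `v` and `f` is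
killed on the `β j` by a polynomial with roots of absolute value `s > 1`, then each term has
values in this line. -/
lemma terms_mem_line (f : Module.End ℂ V) {P : ℂ[X]} (hPm : P.Monic) {s : ℝ} (hs : 1 < s)
    (hP : ∀ z : ℂ, aeval z P = 0 → ‖z‖ = s) (N : ℕ) (γ : V) (β : Fin N → V)
    (hβ : ∀ j, aeval f P (β j) = 0) (v : V)
    (h : ∀ n, ∃ c : ℂ, c • v = γ + ∑ j : Fin N, (f ^ (2 ^ (j : ℕ) * n)) (β j)) :
    (∃ c : ℂ, c • v = γ) ∧ ∀ (j : Fin N) (n : ℕ), ∃ c : ℂ, c • v = (f ^ (2 ^ (j : ℕ) * n)) (β j) := by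
  -- The index `none` stands for the constant term, with root 1. The moduli 1 and s^(2^j) are
  -- pairwise distinct because s > 1.
  let R : Option (Fin N) → ℂ[X] := fun o => o.elim (X - C 1) fun j => powRoots P (2 ^ (j : ℕ))
  let e : Option (Fin N) → ℝ := fun o => o.elim 1 fun j => s ^ 2 ^ (j : ℕ)
  let w : Option (Fin N) → ℕ → V :=
    fun o => o.elim (fun _ => γ) fun j n => (f ^ (2 ^ (j : ℕ) * n)) (β j)
  have he : Function.Injective e := by
    rintro (_ | i) (_ | j) hij
    · rfl
    · exact absurd hij (one_lt_pow₀ hs (by positivity)).ne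
    · exact absurd hij (one_lt_pow₀ hs (by positivity)).ne'
    · have h1 := pow_right_injective₀ (by linarith) hs.ne' hij
      have h2 := Nat.pow_right_injective le_rfl h1
      rw [Fin.ext h2]
  have hRe : ∀ o, ∀ z : ℂ, aeval z (R o) = 0 → ‖z‖ = e o := by
    rintro (_ | j) z hz
    · simpa [e] using norm_of_root_X_sub_C 1 z hz
    · exact norm_of_root_powRoots hPm.ne_zero hP _ z hz
  have key := mem_of_sum_mem_of_coprime (seqShift V) (lineSeq v)
    (fun w hw => seqShift_mem_lineSeq hw) R w
    (fun i j hij => isCoprime_of_norm_roots (he.ne hij) (hRe i) (hRe j))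
    (by
      rintro (_ | j)
      · exact aeval_seqShift_const γ
      · change aeval (seqShift V) (powRoots P (2 ^ (j : ℕ)))
          (fun n => (f ^ (2 ^ (j : ℕ) * n)) (β j)) = 0
        rw [pow_pow_seq, aeval_seqShift_orbit, aeval_pow_powRoots f hPm _ _ (hβ j)]
        ext n
        simp)
    (mem_lineSeq.2 fun n => by
      obtain ⟨c, hc⟩ := h n
      refine ⟨c, hc.trans ?_⟩
      simp [w, Fintype.sum_option])
  exact ⟨mem_lineSeq.1 (key none) 0, fun j n => mem_lineSeq.1 (key (some j)) n⟩

end Shift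

/-! ### The one-variable relation over ℂ -/

section OneVariable

open Polynomial

variable {V : Type*} [AddCommGroup V] [Module ℂ V]

lemma aeval_apply_pow (f : Module.End ℂ V) (P : ℂ[X]) (m : ℕ) (v : V) :
    aeval f P ((f ^ m) v) = (f ^ m) (aeval f P v) := by
  have h : aeval f (P * X ^ m) = aeval f (X ^ m * P) := by rw [mul_comm]
  rw [map_mul, map_mul, map_pow, aeval_X] at h
  exact LinearMap.congr_fun h v

/-- If a constant sequence plus orbits under `f ^ (2 ^ j)`, `j < r`, of vectors killed by a
polynomial in `f` with roots of absolute value `√q` agrees with a combination of the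
`q ^ (2 ^ j * n)`, `j ≤ r`, then the top coefficient of the latter vanishes. -/
lemma top_coeff_eq_zero (f : Module.End ℂ V) {P : ℂ[X]} (hPm : P.Monic) {q : ℕ} (hq : 2 ≤ q)
    (hP : ∀ z : ℂ, aeval z P = 0 → ‖z‖ = Real.sqrt q) (r : ℕ) (γ v : V)
    (β : Fin (r + 1) → V) (hβ : ∀ j, aeval f P (β j) = 0) (c : ℂ) (c' : Fin (r + 1) → ℂ)
    (h : ∀ n, (c + ∑ j : Fin (r + 1), c' j * (q : ℂ) ^ (2 ^ (j : ℕ) * n)) • v =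
      γ + ∑ j : Fin (r + 1), (f ^ (2 ^ (j : ℕ) * n)) (β j)) :
    c' (Fin.last r) • v = 0 := by
  have hq1 : (1 : ℝ) < q := by exact_mod_cast hq
  have hroot : ∀ (j : Fin (r + 1)), IsCoprime (X - C ((q : ℂ) ^ 2 ^ r))
      (powRoots P (2 ^ (j : ℕ))) := by
    intro j
    refine isCoprime_of_norm_roots (s := (q : ℝ) ^ 2 ^ r) (t := Real.sqrt q ^ 2 ^ (j : ℕ)) ?_ ?_
      (norm_of_root_powRoots hPm.ne_zero hP _)
    · have h1 : (1 : ℝ) < Real.sqrt q := by simpa using Real.sqrt_lt_sqrt zero_le_one hq1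
      -- In powers of √q the top frequency has exponent 2^(r+1), while the others reach at most 2^r.
      have h2 : (q : ℝ) ^ 2 ^ r = Real.sqrt q ^ 2 ^ (r + 1) := by
        rw [pow_succ', pow_mul, Real.sq_sqrt (by positivity)]
      rw [h2]
      refine fun e => absurd (Nat.pow_right_injective le_rfl (pow_right_injective₀ (by linarith)
        h1.ne' e)) ?_
      have := j.2
      omega
    · intro z hz
      simpa using norm_of_root_X_sub_C _ z hz
  have hlow : ∀ (j : Fin r), IsCoprime (X - C ((q : ℂ) ^ 2 ^ r))
      (X - C ((q : ℂ) ^ 2 ^ (j : ℕ))) := by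
    intro j
    refine isCoprime_of_norm_roots (s := (q : ℝ) ^ 2 ^ r) (t := (q : ℝ) ^ 2 ^ (j : ℕ)) ?_
      (fun z hz => by simpa using norm_of_root_X_sub_C _ z hz)
      (fun z hz => by simpa using norm_of_root_X_sub_C _ z hz)
    refine fun e => absurd (Nat.pow_right_injective le_rfl (pow_right_injective₀ (by linarith)
        hq1.ne' e)) ?_
    have := j.2
    omega
  have hone : IsCoprime (X - C ((q : ℂ) ^ 2 ^ r)) (X - C 1) := by
    refine isCoprime_of_norm_roots (s := (q : ℝ) ^ 2 ^ r) (t := 1)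
      (one_lt_pow₀ hq1 (by positivity)).ne'
      (fun z hz => by simpa using norm_of_root_X_sub_C _ z hz)
      (fun z hz => by simpa using norm_of_root_X_sub_C _ z hz)
  -- `Q` collects every frequency except q^(2^r). The top term `w` is a combination of the other
  -- terms, hence is killed by both `Q` and X − q^(2^r), which are coprime.
  set Q : ℂ[X] := (X - C 1) * (∏ j : Fin r, (X - C ((q : ℂ) ^ 2 ^ (j : ℕ)))) *
    ∏ j : Fin (r + 1), powRoots P (2 ^ (j : ℕ)) with hQ
  obtain ⟨a, b, hab⟩ : IsCoprime (X - C ((q : ℂ) ^ 2 ^ r)) Q :=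
    (hone.mul_right (IsCoprime.prod_right fun j _ => hlow j)).mul_right
      (IsCoprime.prod_right fun j _ => hroot j)
  have kill : ∀ {R : ℂ[X]} {w : ℕ → V}, R ∣ Q → aeval (seqShift V) R w = 0 →
      aeval (seqShift V) Q w = 0 := by
    rintro R w ⟨S, hS⟩ hw
    rw [hS, mul_comm, map_mul, Module.End.mul_apply, hw, map_zero]
  have geom : ∀ (m : ℕ) (x : ℂ), aeval (seqShift V) (X - C ((q : ℂ) ^ m))
      (fun n => (x * (q : ℂ) ^ (m * n)) • v) = 0 := by
    intro m x
    ext n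
    simp only [map_sub, aeval_X, aeval_C, LinearMap.sub_apply, Pi.sub_apply, seqShift_apply,
      Module.algebraMap_end_apply, Pi.smul_apply, Pi.zero_apply, smul_smul, ← sub_smul]
    rw [mul_add, pow_add, mul_one]
    convert zero_smul ℂ v using 2
    ring
  set w : ℕ → V := fun n => (c' (Fin.last r) * (q : ℂ) ^ (2 ^ r * n)) • v with hw
  have hwsum : w = (fun _ => γ - c • v) +
      ((∑ j : Fin (r + 1), fun n => (f ^ (2 ^ (j : ℕ) * n)) (β j)) -
      ∑ j : Fin r, fun n => (c' j.castSucc * (q : ℂ) ^ (2 ^ (j : ℕ) * n)) • v) := by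
    ext n
    have := h n
    rw [Fin.sum_univ_castSucc, add_smul, add_smul, Finset.sum_smul] at this
    simp only [Fin.val_castSucc, Fin.val_last] at this
    simp only [hw, Pi.add_apply, Pi.sub_apply, Finset.sum_apply]
    rw [← sub_eq_iff_eq_add'] at this
    rw [← this]
    abel
  have hQw : aeval (seqShift V) Q w = 0 := by
    rw [hwsum, map_add, map_sub, map_sum, map_sum, Finset.sum_eq_zero, Finset.sum_eq_zero,
      kill _ (aeval_seqShift_const _)]
    · simp
    · exact (dvd_mul_right _ _).mul_right _
    · intro j _
      exact kill (((Finset.dvd_prod_of_mem (fun j : Fin r => X - C ((q : ℂ) ^ 2 ^ (j : ℕ)))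
        (Finset.mem_univ j)).mul_left _).mul_right _) (geom _ _)
    · intro j _
      refine kill ((Finset.dvd_prod_of_mem (fun j : Fin (r + 1) => powRoots P (2 ^ (j : ℕ)))
        (Finset.mem_univ j)).mul_left _) ?_
      rw [pow_pow_seq, aeval_seqShift_orbit, aeval_pow_powRoots f hPm _ _ (hβ j)]
      ext n
      simp
  have h0 : w = 0 := by
    have h1 : aeval (seqShift V) (a * (X - C ((q : ℂ) ^ 2 ^ r)) + b * Q) w = 0 := by
      rw [map_add, map_mul, map_mul, LinearMap.add_apply, Module.End.mul_apply,
        Module.End.mul_apply, hQw, geom]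
      simp
    rwa [hab, map_one, Module.End.one_apply] at h1
  simpa [hw] using congr_fun h0 0

/-- The key one-variable statement: if `f` is killed by `(X - q) P`, where the roots of `P` have
absolute value `√q`, and no power of `f` has `g` as an eigenvector, then the coefficients of a
sequence `γ + ∑ f ^ (2 ^ j * n) (β j)` on the line of `g` involve only the `q ^ (2 ^ j * n)`
with `j < r`. -/
lemma exists_coeff_of_mem_line (f : Module.End ℂ V) {P : ℂ[X]} (hPm : P.Monic) {q : ℕ}
    (hq : 2 ≤ q) (hP : ∀ z : ℂ, aeval z P = 0 → ‖z‖ = Real.sqrt q)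
    (hf : aeval f ((X - C (q : ℂ)) * P) = 0) (g : V)
    (hg : ∀ m, 0 < m → ∀ ν : ℂ, (f ^ m) g ≠ ν • g) (r : ℕ) (γ : V) (β : Fin (r + 1) → V)
    (a : ℕ → ℂ)
    (h : ∀ n, a n • g = γ + ∑ j : Fin (r + 1), (f ^ (2 ^ (j : ℕ) * n)) (β j)) :
    ∃ (c : ℂ) (c' : Fin r → ℂ), ∀ n, a n = c + ∑ j : Fin r, c' j * (q : ℂ) ^ (2 ^ (j : ℕ) * n) := by
  have hq1 : (1 : ℝ) < q := by exact_mod_cast hq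
  have hs1 : (1 : ℝ) < Real.sqrt q := by simpa using Real.sqrt_lt_sqrt zero_le_one hq1
  obtain ⟨s, t, hst⟩ : IsCoprime (X - C (q : ℂ)) P := by
    refine isCoprime_of_norm_roots (s := q) (t := Real.sqrt q) ?_
      (fun z hz => by simpa using norm_of_root_X_sub_C _ z hz) hP
    intro e
    have h2 := Real.sq_sqrt (show (0 : ℝ) ≤ q by positivity)
    rw [← e] at h2
    nlinarith
  -- The Bézout identity gives the projections onto ker P(f) and ker(f − q).
  set E₀ := aeval f (s * (X - C (q : ℂ))) with hE₀
  set E₁ := aeval f (t * P) with hE₁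
  have hsplit : ∀ v, E₀ v + E₁ v = v := by
    intro v
    rw [← LinearMap.add_apply, hE₀, hE₁, ← map_add, hst]
    simp
  have hE₀P : ∀ v, aeval f P (E₀ v) = 0 := by
    intro v
    rw [hE₀, ← Module.End.mul_apply, ← map_mul,
      show P * (s * (X - C (q : ℂ))) = s * ((X - C (q : ℂ)) * P) by ring, map_mul, hf]
    simp
  have hE₁q : ∀ v, f (E₁ v) = (q : ℂ) • E₁ v := by
    intro v
    have : aeval f (X - C (q : ℂ)) (E₁ v) = 0 := by
      rw [hE₁, ← Module.End.mul_apply, ← map_mul,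
        show (X - C (q : ℂ)) * (t * P) = t * ((X - C (q : ℂ)) * P) by ring, map_mul, hf]
      simp
    rw [map_sub, aeval_X, aeval_C, LinearMap.sub_apply, Module.algebraMap_end_apply] at this
    exact sub_eq_zero.1 this
  have hg0 : g ≠ 0 := fun e => hg 1 one_pos 0 (by simp [e])
  have hproj₀ : ∀ n, a n • E₀ g = E₀ γ + ∑ j : Fin (r + 1), (f ^ (2 ^ (j : ℕ) * n)) (E₀ (β j)) := by
    intro n
    rw [← map_smul, h n, map_add, map_sum]
    simp only [hE₀, aeval_apply_pow]
  have hproj₁ : ∀ n, a n • E₁ g = E₁ γ + ∑ j : Fin (r + 1), (f ^ (2 ^ (j : ℕ) * n)) (E₁ (β j)) := by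
    intro n
    rw [← map_smul, h n, map_add, map_sum]
    simp only [hE₁, aeval_apply_pow]
  by_cases hg1 : E₁ g = 0
  · have hgE : E₀ g = g := by simpa [hg1] using hsplit g
    rw [hgE] at hproj₀
    obtain ⟨⟨c, hc⟩, hβ⟩ := terms_mem_line f hPm hs1 hP (r + 1) (E₀ γ) (fun j => E₀ (β j))
      (fun j => hE₀P _) g (fun n => ⟨a n, hproj₀ n⟩)
    have hzero : ∀ j, E₀ (β j) = 0 := by
      intro j
      -- The values at n = 0 and n = 1 are a vector xg and its image yg under f^(2^j); if x ≠ 0,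
      -- then g is an eigenvector.
      obtain ⟨x, hx⟩ := hβ j 0
      obtain ⟨y, hy⟩ := hβ j 1
      simp only [mul_zero, pow_zero, Module.End.one_apply] at hx
      rw [mul_one, ← hx, map_smul] at hy
      by_cases hx0 : x = 0
      · rw [← hx, hx0, zero_smul]
      · refine absurd ?_ (hg (2 ^ (j : ℕ)) (by positivity) (x⁻¹ * y))
        rw [mul_smul, hy, inv_smul_smul₀ hx0]
    refine ⟨c, 0, fun n => ?_⟩
    have := hproj₀ n
    simp only [hzero, map_zero, Finset.sum_const_zero, add_zero, ← hc] at this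
    simpa using smul_left_injective ℂ hg0 this
  · obtain ⟨⟨c, hc⟩, hβ⟩ := terms_mem_line f (monic_X_sub_C (q : ℂ)) hq1
      (fun z hz => by simpa using norm_of_root_X_sub_C _ z hz) (r + 1) (E₁ γ) (fun j => E₁ (β j))
      (fun j => by
        rw [map_sub, aeval_X, aeval_C, LinearMap.sub_apply, hE₁q, Module.algebraMap_end_apply,
          sub_self]) (E₁ g) (fun n => ⟨a n, hproj₁ n⟩)
    choose c' hc' using fun j => hβ j 0
    simp only [mul_zero, pow_zero, Module.End.one_apply] at hc'
    have ha : ∀ n, a n = c + ∑ j : Fin (r + 1), c' j * (q : ℂ) ^ (2 ^ (j : ℕ) * n) := by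
      intro n
      apply smul_left_injective ℂ hg1
      have hpow : ∀ (j : Fin (r + 1)), (f ^ (2 ^ (j : ℕ) * n)) (E₁ (β j)) =
          (c' j * (q : ℂ) ^ (2 ^ (j : ℕ) * n)) • E₁ g := by
        intro j
        rw [pow_apply_of_eigen (hE₁q _), ← hc', smul_smul, mul_comm]
      simp only [hproj₁ n, hpow, ← hc, add_smul, Finset.sum_smul]
    have htop := top_coeff_eq_zero f hPm hq hP r (E₀ γ) (E₀ g) (fun j => E₀ (β j))
      (fun j => hE₀P _) c c' (fun n => by rw [← ha, hproj₀])
    have hlast : c' (Fin.last r) = 0 := by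
      rcases smul_eq_zero.1 htop with h0 | h0
      · exact h0
      · have hgE : E₁ g = g := by simpa [h0] using hsplit g
        refine absurd ?_ (hg 1 one_pos q)
        rw [pow_one]
        simpa [hgE] using hE₁q g
    refine ⟨c, fun j => c' j.castSucc, fun n => ?_⟩
    rw [ha, Fin.sum_univ_castSucc, hlast]
    simp

end OneVariable

/-! ### Descent from ℂ ⊗ M to the abelian group M -/

section Group

open Polynomial TensorProduct

variable {M : Type*} [AddCommGroup M]

lemma exists_smul_eq_zero_of_one_tmul {z : M} (h : (1 : ℚ) ⊗ₜ[ℤ] z = 0) :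
    ∃ N : ℤ, N ≠ 0 ∧ N • z = 0 := by
  obtain ⟨s, hs⟩ := (IsLocalizedModule.eq_zero_iff (nonZeroDivisors ℤ)
    (TensorProduct.mk ℤ ℚ M 1) (m := z)).1 h
  exact ⟨s, nonZeroDivisors.coe_ne_zero s, hs⟩

/-- A `ℚ`-linear retraction of `ℚ ⊆ ℂ`. -/
lemma exists_retraction : ∃ ρ : ℂ →ₗ[ℚ] ℚ, ∀ x : ℚ, ρ (x : ℂ) = x := by
  obtain ⟨ρ, hρ⟩ := (Algebra.linearMap ℚ ℂ).exists_leftInverse_of_injective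
    (LinearMap.ker_eq_bot.2 (algebraMap ℚ ℂ).injective)
  exact ⟨ρ, fun x => LinearMap.congr_fun hρ x⟩

/-- A ℚ-linear retraction ℂ → ℚ replaces ν by a rational number. Clearing its denominator leaves an
element dying in ℚ ⊗ M, hence torsion, which a further factor kills. -/
lemma exists_smul_eq_smul_of_tmul_eq {x y : M} {ν : ℂ} (h : (1 : ℂ) ⊗ₜ[ℤ] y = ν ⊗ₜ[ℤ] x) :
    ∃ N : ℤ, N ≠ 0 ∧ ∃ p : ℤ, N • y = p • x := by
  obtain ⟨ρ, hρ⟩ := exists_retraction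
  have h1 := congr_arg (LinearMap.rTensor M (ρ.restrictScalars ℤ)) h
  simp only [LinearMap.rTensor_tmul, LinearMap.restrictScalars_apply] at h1
  rw [show ρ 1 = 1 by simpa using hρ 1] at h1
  set s := ρ ν
  have h2 : (1 : ℚ) ⊗ₜ[ℤ] ((s.den : ℤ) • y - s.num • x) = 0 := by
    rw [tmul_sub, ← smul_tmul, ← smul_tmul, smul_tmul, tmul_smul, h1, smul_tmul', ← sub_tmul]
    have e : (s.den : ℤ) • s - s.num • (1 : ℚ) = 0 := by
      rw [zsmul_eq_mul, zsmul_eq_mul, mul_one, sub_eq_zero]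
      exact_mod_cast Rat.den_mul_eq_num s
    rw [e, zero_tmul]
  obtain ⟨N, hN, h3⟩ := exists_smul_eq_zero_of_one_tmul h2
  refine ⟨N * s.den, mul_ne_zero hN (by exact_mod_cast s.den_nz), N * s.num, ?_⟩
  rwa [smul_sub, smul_smul, smul_smul, sub_eq_zero] at h3

lemma toIntLinearMap_pow_apply (F : AddMonoid.End M) (n : ℕ) (x : M) :
    ((AddMonoidHom.toIntLinearMap F : Module.End ℤ M) ^ n) x = (F ^ n) x := by
  induction n with
  | zero => rfl
  | succ n ih =>
    rw [pow_succ', pow_succ', Module.End.mul_apply, ih]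
    rfl

lemma baseChange_pow_one_tmul (F : AddMonoid.End M) (n : ℕ) (x : M) :
    ((LinearMap.baseChange ℂ (AddMonoidHom.toIntLinearMap F) : Module.End ℂ (ℂ ⊗[ℤ] M)) ^ n)
      (1 ⊗ₜ x) = 1 ⊗ₜ (F ^ n) x := by
  rw [← LinearMap.baseChange_pow, LinearMap.baseChange_tmul, toIntLinearMap_pow_apply]

lemma aeval_baseChange (F : Module.End ℤ M) (P : ℤ[X]) :
    aeval (LinearMap.baseChange ℂ F : Module.End ℂ (ℂ ⊗[ℤ] M)) (P.map (Int.castRingHom ℂ)) =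
      LinearMap.baseChange ℂ (aeval F P) := by
  have h := aeval_algHom_apply (Module.End.baseChangeHom ℤ ℂ M) F P
  have h' := aeval_map_algebraMap ℂ (LinearMap.baseChange ℂ F : Module.End ℂ (ℂ ⊗[ℤ] M)) P
  exact h'.trans h

/-- If no power of `F` preserves a nonzero subgroup of `ℤ g` and `F` is killed by a monic integer
polynomial, then `g` is not an eigenvector of a power of `F` in `ℂ ⊗ M`. -/
lemma not_eigenvector (F : AddMonoid.End M) {g : M} (hg : ¬ IsOfFinAddOrder g)
    {P : ℤ[X]} (hPm : P.Monic) (hP : aeval (AddMonoidHom.toIntLinearMap F : Module.End ℤ M) P = 0)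
    (hinv : ∀ m : ℕ, 0 < m → ∀ H : AddSubgroup M, H ≤ AddSubgroup.zmultiples g →
      (∀ x ∈ H, (F ^ m) x ∈ H) → H = ⊥) (m : ℕ) (hm : 0 < m) (ν : ℂ) :
    ((LinearMap.baseChange ℂ (AddMonoidHom.toIntLinearMap F) : Module.End ℂ (ℂ ⊗[ℤ] M)) ^ m)
      (1 ⊗ₜ g) ≠ ν • ((1 : ℂ) ⊗ₜ[ℤ] g) := by
  intro h
  have hsmul : ∀ n : ℤ, n ≠ 0 → n • g ≠ 0 := fun n hn e =>
    hg (isOfFinAddOrder_iff_zsmul_eq_zero.2 ⟨n, hn, e⟩)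
  have hg1 : (1 : ℂ) ⊗ₜ[ℤ] g ≠ 0 := by
    intro e
    obtain ⟨N, hN, p, hp⟩ := exists_smul_eq_smul_of_tmul_eq (x := (0 : M)) (y := g) (ν := 0)
      (by rw [e, tmul_zero])
    exact hsmul N hN (by rw [hp, smul_zero])
  rw [baseChange_pow_one_tmul, smul_tmul', smul_eq_mul, mul_one] at h
  -- F^m is integral over ℤ along with F, and its eigenvalue ν is a root of the same monic
  -- polynomial.
  have hint : IsIntegral ℤ ν := by
    have hF : IsIntegral ℤ (AddMonoidHom.toIntLinearMap F : Module.End ℤ M) := ⟨P, hPm, hP⟩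
    obtain ⟨W, hW, hW0⟩ := hF.pow m
    refine ⟨W, hW, ?_⟩
    have e := aeval_baseChange ((AddMonoidHom.toIntLinearMap F : Module.End ℤ M) ^ m) W
    rw [show aeval ((AddMonoidHom.toIntLinearMap F : Module.End ℤ M) ^ m) W = 0 from hW0,
      LinearMap.baseChange_zero] at e
    have hev : Module.End.HasEigenvector (LinearMap.baseChange ℂ
        ((AddMonoidHom.toIntLinearMap F : Module.End ℤ M) ^ m)) ν ((1 : ℂ) ⊗ₜ[ℤ] g) := by
      refine Module.End.hasEigenvector_iff.2 ⟨Module.End.mem_eigenspace_iff.2 ?_, hg1⟩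
      rw [LinearMap.baseChange_tmul, toIntLinearMap_pow_apply, h, smul_tmul', smul_eq_mul, mul_one]
    have e2 := Module.End.aeval_apply_of_hasEigenvector (p := W.map (Int.castRingHom ℂ)) hev
    rw [e, LinearMap.zero_apply, eq_comm, smul_eq_zero, or_iff_left hg1, Polynomial.eval_map] at e2
    exact e2
  obtain ⟨N, hN, p, hp⟩ := exists_smul_eq_smul_of_tmul_eq h
  -- Being rational as well as integral, ν is an integer z.
  have hν : ν = algebraMap ℚ ℂ ((p : ℚ) / N) := by
    have e : ((N : ℂ) * ν - p) • ((1 : ℂ) ⊗ₜ[ℤ] g) = 0 := by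
      have e1 := congr_arg (fun z => (1 : ℂ) ⊗ₜ[ℤ] z) hp
      simp only [tmul_smul, h] at e1
      rw [sub_smul, sub_eq_zero, mul_smul, Int.cast_smul_eq_zsmul, Int.cast_smul_eq_zsmul, ← e1,
        smul_tmul', smul_eq_mul, mul_one]
    have e2 := (smul_eq_zero.1 e).resolve_right hg1
    have hN' : (N : ℂ) ≠ 0 := by exact_mod_cast hN
    simp only [eq_ratCast]
    push_cast
    rw [eq_div_iff hN', mul_comm]
    exact sub_eq_zero.1 e2
  obtain ⟨z, hz⟩ := IsIntegrallyClosed.isIntegral_iff.1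
    ((isIntegral_algebraMap_iff (algebraMap ℚ ℂ).injective).1 (hν ▸ hint))
  have hpz : p = z * N := by
    have hN' : (N : ℚ) ≠ 0 := by exact_mod_cast hN
    have : (z : ℚ) = p / N := hz
    rw [eq_div_iff hN'] at this
    exact_mod_cast this.symm
  -- F^m g = zg may fail by torsion, but F^m(Ng) = z(Ng) holds exactly, so ℤNg is stable.
  have hbot := hinv m hm (AddSubgroup.zmultiples (N • g))
    (AddSubgroup.zmultiples_le_of_mem (AddSubgroup.zsmul_mem_zmultiples g N)) (by
      intro x hx
      obtain ⟨k, rfl⟩ := AddSubgroup.mem_zmultiples_iff.1 hx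
      rw [map_zsmul, map_zsmul, hp, hpz, mul_smul, smul_smul]
      exact AddSubgroup.zsmul_mem_zmultiples _ _)
  exact hsmul N hN (AddSubgroup.zmultiples_eq_bot.1 hbot)

/-- Rational coefficients for a one-variable family of the shape
`γ + ∑ F ^ (2 ^ j * n) (β j)` contained in `ℤ g`. -/
lemma exists_rat_coeff (F : AddMonoid.End M) {g : M} (hg : ¬ IsOfFinAddOrder g)
    {q : ℕ} (hq : 2 ≤ q) {P : ℤ[X]} (hPm : P.Monic)
    (hroots : ∀ z : ℂ, aeval z P = 0 → ‖z‖ = Real.sqrt q)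
    (hP : aeval (AddMonoidHom.toIntLinearMap F : Module.End ℤ M) ((X - C (q : ℤ)) * P) = 0)
    (hinv : ∀ m : ℕ, 0 < m → ∀ H : AddSubgroup M, H ≤ AddSubgroup.zmultiples g →
      (∀ x ∈ H, (F ^ m) x ∈ H) → H = ⊥) (r : ℕ) (γ : M) (β : Fin (r + 1) → M) (a : ℕ → ℤ)
    (h : ∀ n, a n • g = γ + ∑ j : Fin (r + 1), (F ^ (2 ^ (j : ℕ) * n)) (β j)) :
    ∃ (c : ℚ) (c' : Fin r → ℚ), ∀ n,
      (a n : ℚ) = c + ∑ j : Fin r, c' j * (q : ℚ) ^ (2 ^ (j : ℕ) * n) := by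
  obtain ⟨c, c', hc⟩ := exists_coeff_of_mem_line
    (LinearMap.baseChange ℂ (AddMonoidHom.toIntLinearMap F) : Module.End ℂ (ℂ ⊗[ℤ] M))
    (hPm.map (Int.castRingHom ℂ)) hq
    (fun z hz => hroots z (by rwa [← aeval_map_algebraMap ℂ]))
    (by
      have := aeval_baseChange (AddMonoidHom.toIntLinearMap F : Module.End ℤ M)
        ((X - C (q : ℤ)) * P)
      rw [hP, LinearMap.baseChange_zero] at this
      rwa [Polynomial.map_mul, Polynomial.map_sub, map_X, map_C, map_natCast] at this)
    ((1 : ℂ) ⊗ₜ g) (not_eigenvector F hg ((monic_X_sub_C _).mul hPm) hP hinv) r (1 ⊗ₜ γ)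
    (fun j => 1 ⊗ₜ β j) (fun n => a n) (by
      intro n
      simp only [baseChange_pow_one_tmul]
      rw [← tmul_sum, ← tmul_add, ← h, tmul_smul, Int.cast_smul_eq_zsmul])
  -- The values and the powers of q are rational, so ρ turns the complex coefficients into rational
  -- ones.
  obtain ⟨ρ, hρ⟩ := exists_retraction
  refine ⟨ρ c, fun j => ρ (c' j), fun n => ?_⟩
  have h1 := congr_arg ρ (hc n)
  rw [show ((a n : ℤ) : ℂ) = ((a n : ℚ) : ℂ) by norm_cast, hρ, map_add, map_sum] at h1
  rw [h1]
  congr 1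
  refine Finset.sum_congr rfl fun j _ => ?_
  rw [show c' j * (q : ℂ) ^ (2 ^ (j : ℕ) * n) = ((q : ℚ) ^ (2 ^ (j : ℕ) * n)) • c' j by
    rw [Rat.smul_def, mul_comm]; norm_cast, map_smul, smul_eq_mul, mul_comm]

/-- The statement for an endomorphism `F` of an arbitrary abelian group. -/
theorem exists_widelyPSet_eq (F : AddMonoid.End M) {g : M} (hg : ¬ IsOfFinAddOrder g)
    {q : ℕ} (hq : 2 ≤ q) {P : ℤ[X]} (hPm : P.Monic)
    (hroots : ∀ z : ℂ, aeval z P = 0 → ‖z‖ = Real.sqrt q)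
    (hP : aeval (AddMonoidHom.toIntLinearMap F : Module.End ℤ M) ((X - C (q : ℤ)) * P) = 0)
    (hinv : ∀ m : ℕ, 0 < m → ∀ H : AddSubgroup M, H ≤ AddSubgroup.zmultiples g →
      (∀ x ∈ H, (F ^ m) x ∈ H) → H = ⊥) (d r : ℕ) (α₀ : M) (α : Fin d → Fin (r + 1) → M)
    (hS : Semiabelian.widelyFSet F d r α₀ α ⊆ (AddSubgroup.zmultiples g : Set M)) :
    ∃ (c₀ : ℚ) (c : Fin d → Fin r → ℚ),
      (fun n : ℤ => (n : ℚ)) '' {n : ℤ | n • g ∈ Semiabelian.widelyFSet F d r α₀ α} =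
        Semiabelian.widelyPSet q d r c₀ c := by
  have hinj : ∀ m n : ℤ, m • g = n • g → m = n := by
    intro m n e
    by_contra hmn
    exact hg (isOfFinAddOrder_iff_zsmul_eq_zero.2
      ⟨m - n, sub_ne_zero.2 hmn, by rw [sub_smul, e, sub_self]⟩)
  let u : Fin d → ℕ → M := fun i n => ∑ j : Fin (r + 1), (F ^ (2 ^ (j : ℕ) * n)) (α i j)
  have hu : ∀ n : Fin d → ℕ, ∃ b : ℤ, b • g = α₀ + ∑ i, u i (n i) :=
    fun n => AddSubgroup.mem_zmultiples_iff.1 (hS ⟨n, rfl⟩)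
  choose b hb using hu
  -- All variables but the i-th are frozen at 0; their contribution joins the constant γ.
  have hone : ∀ i, ∃ (c : ℚ) (c' : Fin r → ℚ), ∀ n,
      (b (Function.update 0 i n) : ℚ) = c + ∑ j : Fin r, c' j * (q : ℚ) ^ (2 ^ (j : ℕ) * n) := by
    intro i
    refine exists_rat_coeff F hg hq hPm hroots hP hinv r
      (α₀ + ∑ i' ∈ Finset.univ.erase i, u i' 0) (α i) _ fun n => ?_
    rw [hb, ← Finset.sum_erase_add _ _ (Finset.mem_univ i), Function.update_self, add_assoc]
    congr 2
    refine Finset.sum_congr rfl fun i' hi' => ?_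
    rw [Function.update_of_ne (Finset.ne_of_mem_erase hi')]
    rfl
  choose c c' hc using hone
  have hadd : ∀ n : Fin d → ℕ,
      b n = b 0 + ∑ i, (b (Function.update 0 i (n i)) - b 0) := by
    intro n
    apply hinj
    rw [add_smul, Finset.sum_smul, hb, hb, add_assoc, ← Finset.sum_add_distrib]
    congr 1
    refine Finset.sum_congr rfl fun i _ => ?_
    rw [sub_smul, hb, hb, ← Finset.sum_erase_add _ _ (Finset.mem_univ i),
      ← Finset.sum_erase_add (s := Finset.univ) (fun i' => u i' ((0 : Fin d → ℕ) i'))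
        (Finset.mem_univ i), Function.update_self]
    have e : ∑ i' ∈ Finset.univ.erase i, u i' (Function.update (0 : Fin d → ℕ) i (n i) i') =
        ∑ i' ∈ Finset.univ.erase i, u i' ((0 : Fin d → ℕ) i') :=
      Finset.sum_congr rfl fun i' hi' => by
        rw [Function.update_of_ne (Finset.ne_of_mem_erase hi')]
    rw [e]
    abel
  have hval : ∀ n : Fin d → ℕ, (b n : ℚ) = (b 0 + ∑ i, (c i - b 0)) +
      ∑ i, ∑ j : Fin r, c' i j * (q : ℚ) ^ (2 ^ (j : ℕ) * n i) := by
    intro n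
    rw [hadd n]
    push_cast
    rw [add_assoc, ← Finset.sum_add_distrib]
    congr 1
    refine Finset.sum_congr rfl fun i _ => ?_
    rw [hc]
    ring
  -- Each one-variable formula contains b(0) in its constant, so it is subtracted d times and
  -- restored once.
  refine ⟨b 0 + ∑ i, (c i - b 0), c', Set.ext fun x => ⟨?_, ?_⟩⟩
  · rintro ⟨m, ⟨n, hn⟩, rfl⟩
    refine ⟨n, ?_⟩
    rw [← hval n]
    exact congr_arg _ (hinj _ _ (hn.trans (hb n).symm))
  · rintro ⟨n, rfl⟩
    exact ⟨b n, ⟨n, hb n⟩, hval n⟩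

end Group

/-! ### From endomorphisms of the group scheme to its K-points -/

namespace Semiabelian

open scoped MonObj

variable {K : Type u} [Field K]

/-- Evaluating self-maps of `G` at a `K`-point, as a homomorphism to `G(K)`. -/
noncomputable def evalAt {G : CommGroupScheme K} (x : Points G) : SelfMaps G →+ Points G :=
  MonoidHom.toAdditive
    { toFun := fun f : G.X ⟶ G.X =>
        (show 𝟙_ (Over (Spec (CommRingCat.of K))) ⟶ G.X from x) ≫ f
      map_one' := MonObj.comp_one _
      map_mul' := fun _ _ => MonObj.comp_mul _ _ _ }

lemma evalAt_selfMap {G : CommGroupScheme K} (F : End G) (x : Points G) :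
    evalAt x (selfMap F) = onPoints F x := rfl

lemma onPoints_one {G : CommGroupScheme K} : onPoints (1 : End G) = 1 := by
  ext x
  exact Category.comp_id (show 𝟙_ (Over (Spec (CommRingCat.of K))) ⟶ G.X from x)

/-- Products in `End G` follow the order of function composition, so the action on points does not
reverse them. -/
lemma onPoints_mul {G : CommGroupScheme K} (F F' : End G) :
    onPoints (F * F') = onPoints F * onPoints F' := by
  ext x
  exact (Category.assoc (show 𝟙_ (Over (Spec (CommRingCat.of K))) ⟶ G.X from x)
    (schemeHom F') (schemeHom F)).symm

lemma onPoints_pow {G : CommGroupScheme K} (F : End G) (n : ℕ) :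
    onPoints (F ^ n) = onPoints F ^ n := by
  induction n with
  | zero => rw [pow_zero, pow_zero, onPoints_one]
  | succ n ih => rw [pow_succ, pow_succ, onPoints_mul, ih]

/-- An integer polynomial which kills `F` kills the induced endomorphism of `G(K)`. -/
lemma aeval_onPoints_eq_zero {G : CommGroupScheme K} (F : End G) (P : Polynomial ℤ)
    (h : polyEval F P = 0) :
    Polynomial.aeval (AddMonoidHom.toIntLinearMap (onPoints F) : Module.End ℤ (Points G)) P = 0 := by
  ext x
  -- Evaluation at x is additive, so the relation among self-maps can be evaluated term by term.
  have h1 := congr_arg (evalAt x) h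
  rw [polyEval, Polynomial.sum_def, map_sum, map_zero] at h1
  rw [Polynomial.aeval_def, Polynomial.eval₂_eq_sum, Polynomial.sum_def, LinearMap.sum_apply, LinearMap.zero_apply]
  refine Eq.trans (Finset.sum_congr rfl fun i _ => ?_) h1
  rw [map_zsmul, evalAt_selfMap, onPoints_pow, Module.End.mul_apply, Module.algebraMap_end_apply,
    toIntLinearMap_pow_apply]

end Semiabelian

theorem proposition2p12 {k K : Type u} [Field k] [Fintype k] [Field K] [IsAlgClosed K]
    [Algebra k K]
    (G₀ : Semiabelian.CommGroupScheme k)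
    (hG : Semiabelian.IsSemiabelian ((Semiabelian.baseChange k K).obj G₀))
    (g : Semiabelian.Points ((Semiabelian.baseChange k K).obj G₀))
    (hg : ¬ IsOfFinAddOrder g)
    (d r : ℕ) (hd : 0 < d)
    (α₀ : Semiabelian.Points ((Semiabelian.baseChange k K).obj G₀))
    (α : Fin d → Fin (r + 1) → Semiabelian.Points ((Semiabelian.baseChange k K).obj G₀))
    (hS : Semiabelian.widelyFSet (Semiabelian.onPoints (Semiabelian.frobenius K G₀)) d r α₀ α ⊆
      (AddSubgroup.zmultiples g : Set (Semiabelian.Points ((Semiabelian.baseChange k K).obj G₀))))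
    (P₀ : Polynomial ℤ) (hP₀ : P₀.Monic)
    (hroots : ∀ z : ℂ, Polynomial.aeval z P₀ = 0 → ‖z‖ = Real.sqrt (Fintype.card k))
    (hP : Semiabelian.polyEval (Semiabelian.frobenius K G₀)
      ((Polynomial.X - Polynomial.C (Fintype.card k : ℤ)) * P₀) = 0)
    (hinv : ∀ m : ℕ, 0 < m →
      ∀ H : AddSubgroup (Semiabelian.Points ((Semiabelian.baseChange k K).obj G₀)),
        H ≤ AddSubgroup.zmultiples g →
        (∀ x ∈ H, (Semiabelian.onPoints (Semiabelian.frobenius K G₀) ^ m) x ∈ H) → H = ⊥) :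
    ∃ (c₀ : ℚ) (c : Fin d → Fin r → ℚ),
      (fun n : ℤ => (n : ℚ)) '' {n : ℤ | n • g ∈ Semiabelian.widelyFSet
        (Semiabelian.onPoints (Semiabelian.frobenius K G₀)) d r α₀ α} =
      Semiabelian.widelyPSet (Fintype.card k) d r c₀ c :=
  exists_widelyPSet_eq _ hg Fintype.one_lt_card hP₀ hroots
    (Semiabelian.aeval_onPoints_eq_zero _ _ hP) hinv d r α₀ α hS
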